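/- Let $G$ be a compact Lie group with normalized Haar measure $\mu$ (write $dx=d\mu(x)$), and let $\hat G$ be the set of equivalence classes $[\xi]$ of continuous irreducible unitary representations of $G$; for each class fix a representative $\xi:G\to U(d_\xi)$ in matrix form. For $f\in L^2(G)$ put $\hat f(\xi)=\int_G f(x)\,\xi(x)^*\,dx\in\mathbb C^{d_\xi\times d_\xi}$. Let $k\in L^2(G)$, let $K:G\times G\to\mathbb C$ satisfy $K(x,y)=k(y^{-1}x)$ for almost every $(x,y)$, and let $T:L^2(G)\to L^2(G)$ be the bounded (left-invariant) linear operator $$Tf(x)=\int_G K(x,y)f(y)\,dy\quad\text{for a.e. }x\in G,\ f\in L^2(G),$$ with matrix symbol $\sigma_T(\xi):=\hat k(\xi)$. Then $K$ is given by the symbol expansion $$K(x,y)=\sum_{[\xi]\in\hat G}d_\xi\,\mathrm{Tr}\bigl[\xi(x)\,\sigma_T(\xi)\,\xi(y)^*\bigr],$$ with unconditional convergence in $L^2(G\times G)$, and the following conditions are equivalent: 1. $K$ is symmetric: $K(x,y)=\overline{K(y,x)}$ for almost every $(x,y)\in G\times G$. 2. The matrix $\sigma_T(\xi)$ is Hermitian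 for every $[\xi]\in\hat G$. 3. $T$ is self-adjoint. -/

import Mathlib

open MeasureTheory Filter Topology
open scoped Matrix Manifold ContDiff

noncomputable section

namespace CompactLieKernel

/-- The complex linear representation `x ↦ (v ↦ ξ(x) v)` on `ℂ^d` attached to a unitary
matrix-valued homomorphism `ξ`. -/
def matrixRep {G : Type*} [Group G] {d : ℕ} (ξ : G →* Matrix.unitaryGroup (Fin d) ℂ) :
    Representation ℂ G (Fin d → ℂ) :=
  (Matrix.toLinAlgEquiv' : Matrix (Fin d) (Fin d) ℂ ≃ₐ[ℂ] _).toMonoidHom.comp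
    ((Matrix.unitaryGroup (Fin d) ℂ).subtype.comp ξ)

/-- A continuous irreducible unitary representation of `G`, written in matrix form in an
orthonormal basis of the representation space. (For compact `G` every continuous irreducible
unitary representation is finite-dimensional, so all of them arise in this way.) -/
structure UnitaryIrrep (G : Type*) [Group G] [TopologicalSpace G] where
  /-- The dimension `d_ξ`. -/
  dim : ℕ
  toHom : G →* Matrix.unitaryGroup (Fin dim) ℂ
  continuous_toHom : Continuous toHom
  irreducible : (matrixRep toHom).IsIrreducible

namespace UnitaryIrrep

variable {G : Type*} [Group G] [TopologicalSpace G]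

/-- The matrix `ξ(x)`. -/
def mat (ξ : UnitaryIrrep G) (x : G) : Matrix (Fin ξ.dim) (Fin ξ.dim) ℂ := (ξ.toHom x).1

/-- Unitary equivalence: `ξ(x) U = U η(x)` for all `x`, for some unitary `U`. -/
def Equivalent (ξ η : UnitaryIrrep G) : Prop :=
  ∃ U : Matrix (Fin ξ.dim) (Fin η.dim) ℂ,
    U * Uᴴ = 1 ∧ Uᴴ * U = 1 ∧ ∀ x, ξ.mat x * U = U * η.mat x

theorem equivalent_equivalence : Equivalence (Equivalent (G := G)) where
  refl ξ := ⟨1, by simp, by simp, by simp⟩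
  symm := by
    rintro ξ η ⟨U, h1, h2, h⟩
    refine ⟨Uᴴ, by simpa using h2, by simpa using h1, fun x => ?_⟩
    calc η.mat x * Uᴴ = (Uᴴ * U) * η.mat x * Uᴴ := by rw [h2, Matrix.one_mul]
      _ = Uᴴ * (ξ.mat x * U) * Uᴴ := by rw [h x]; simp only [Matrix.mul_assoc]
      _ = Uᴴ * ξ.mat x * (U * Uᴴ) := by simp only [Matrix.mul_assoc]
      _ = Uᴴ * ξ.mat x := by rw [h1, Matrix.mul_one]
  trans := by
    rintro ξ η ζ ⟨U, h1, h2, h⟩ ⟨V, k1, k2, k⟩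
    refine ⟨U * V, ?_, ?_, fun x => ?_⟩
    · calc U * V * (U * V)ᴴ = U * (V * Vᴴ) * Uᴴ := by
            simp only [Matrix.conjTranspose_mul, Matrix.mul_assoc]
        _ = 1 := by rw [k1, Matrix.mul_one, h1]
    · calc (U * V)ᴴ * (U * V) = Vᴴ * (Uᴴ * U) * V := by
            simp only [Matrix.conjTranspose_mul, Matrix.mul_assoc]
        _ = 1 := by rw [h2, Matrix.mul_one, k2]
    · rw [← Matrix.mul_assoc, h x, Matrix.mul_assoc, k x, Matrix.mul_assoc]

instance setoid (G : Type*) [Group G] [TopologicalSpace G] : Setoid (UnitaryIrrep G) :=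
  ⟨Equivalent, equivalent_equivalence⟩

end UnitaryIrrep

/-- The unitary dual `Ĝ`: equivalence classes of continuous irreducible unitary
representations of `G`. -/
abbrev UnitaryDual (G : Type*) [Group G] [TopologicalSpace G] : Type _ :=
  Quotient (UnitaryIrrep.setoid G)

section Kernel

variable {G : Type*} [Group G] [TopologicalSpace G] [MeasurableSpace G]

/-- The group Fourier transform `f̂(ξ) = ∫ f(x) ξ(x)^* dμ(x)`, that is,
`f̂(ξ)_{ij} = ⟨f, ξ_{ji}⟩`. For a left-invariant operator with right convolution kernel `k`,
its matrix symbol is `σ_T(ξ) = k̂(ξ)`. -/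
def fourier (μ : Measure G) (f : G → ℂ) (ξ : UnitaryIrrep G) :
    Matrix (Fin ξ.dim) (Fin ξ.dim) ℂ :=
  Matrix.of fun i j => ∫ x, f x * star (ξ.mat x j i) ∂μ

/-- `T` is the integral operator on `L²(G)` with kernel `K`:
`T f (x) = ∫ K(x,y) f(y) dμ(y)` for almost every `x`. -/
def HasIntegralKernel (μ : Measure G) (T : Lp ℂ 2 μ →L[ℂ] Lp ℂ 2 μ) (K : G → G → ℂ) : Prop :=
  ∀ f : Lp ℂ 2 μ, T f =ᵐ[μ] fun x => ∫ y, K x y * f y ∂μ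

/-- `K(x,y) = conj K(y,x)` for almost every `x, y`. -/
def IsSymmetricKernel (μ : Measure G) (K : G → G → ℂ) : Prop :=
  ∀ᵐ p ∂(μ.prod μ), K p.1 p.2 = star (K p.2 p.1)

/-- The term `d_ξ Tr[ξ(x) σ ξ(y)^*]` of the symbol expansion. -/
def kernelTerm (ξ : UnitaryIrrep G) (σ : Matrix (Fin ξ.dim) (Fin ξ.dim) ℂ) (x y : G) : ℂ :=
  (ξ.dim : ℂ) * (ξ.mat x * σ * (ξ.mat y)ᴴ).trace

/-- `K(x,y) = ∑_{[ξ] ∈ Ĝ} d_ξ Tr[ξ(x) σ(ξ) ξ(y)^*]`, as an unconditionally convergent series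
in `L²(G × G)`; `rep` chooses a representative `ξ` in every class `[ξ]`. -/
def HasSymbolExpansion (μ : Measure G) (rep : UnitaryDual G → UnitaryIrrep G)
    (σ : (ξ : UnitaryIrrep G) → Matrix (Fin ξ.dim) (Fin ξ.dim) ℂ) (K : G → G → ℂ) : Prop :=
  Tendsto
    (fun s : Finset (UnitaryDual G) =>
      eLpNorm (fun p : G × G => K p.1 p.2 - ∑ c ∈ s, kernelTerm (rep c) (σ (rep c)) p.1 p.2)
        2 (μ.prod μ))
    atTop (𝓝 0)

end Kernel

end CompactLieKernel

end

/-! Since ξ(y)^* ξ(x) = ξ(y⁻¹x), everything reduces to the single function k on G. The map (x,y) ↦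
y⁻¹x preserves measure, so the symbol expansion of K is the pullback of the Fourier series of k
(`tendsto_eLpNorm_fourier`). Symmetry of K means k(z) = conj k(z⁻¹) a.e.; the right side has
transform σᴴ, so injectivity of the Fourier transform gives 1 ⇔ 2. Moreover T ξ_{ij} = ∑_m σ_{mj}
ξ_{im} (`apply_coeff`), so in the basis √d_ξ ξ_{ij} the operator T is block diagonal with blocks
σ(ξ), which gives 3 ⇔ 2.

All of this rests on that basis. Orthonormality is Schur's lemma applied to averaged matrix units.
For completeness, suppose some f ≠ 0 is orthogonal to all coefficients. Averaging the rank one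
operators v ↦ ⟨π(x)f, v⟩ π(x)f over G gives a nonzero compact symmetric operator that commutes with
translations. An eigenspace for a nonzero eigenvalue is finite-dimensional and invariant, hence
contains an irreducible piece; its vectors are combinations of matrix coefficients, yet orthogonal
to all of them. -/

noncomputable section

namespace CompactLieKernel

/-! ### Finite-dimensional invariant subspaces of unitary representations of compact groups -/

section UnitaryRepresentation

open InnerProductSpace Module.End

variable {G H : Type*} [Group G] [NormedAddCommGroup H] [InnerProductSpace ℂ H]

/-- `E` is stable under the unitary representation `π`. -/
def IsInvariant (π : G →* (H ≃ₗᵢ[ℂ] H)) (E : Submodule ℂ H) : Prop :=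
  ∀ x, ∀ v ∈ E, π x v ∈ E

/-- Strong continuity of π becomes operator-norm continuity here, so the average below is a Bochner
integral in operator norm. -/
theorem continuous_rankOne_orbit [TopologicalSpace G] {π : G →* (H ≃ₗᵢ[ℂ] H)}
    (hπ : ∀ v, Continuous fun x => π x v) (f : H) :
    Continuous fun x => rankOne ℂ (π x f) (π x f) := by
  exact (((ContinuousLinearMap.smulRightL ℂ H H).continuous.comp
    (innerSL ℂ).continuous).clm_apply continuous_id).comp (hπ f)

variable [CompleteSpace H] [TopologicalSpace G] [CompactSpace G] [MeasurableSpace G] [BorelSpace G]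

/-- The average of the rank one operators attached to the orbit of a vector. -/
def orbitAverage (μ : Measure G) (π : G →* (H ≃ₗᵢ[ℂ] H)) (f : H) : H →L[ℂ] H :=
  ∫ x, rankOne ℂ (π x f) (π x f) ∂μ

variable {μ : Measure G} [IsProbabilityMeasure μ] {π : G →* (H ≃ₗᵢ[ℂ] H)}

omit [Group G] in
theorem integrable_of_continuous {E : Type*} [NormedAddCommGroup E] {f : G → E}
    (hf : Continuous f) : Integrable f μ := by
  exact hf.integrable_of_hasCompactSupport (HasCompactSupport.of_compactSpace _)

omit [CompleteSpace H] in
theorem orbitAverage_apply (hπ : ∀ v, Continuous fun x => π x v) (f v : H) :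
    orbitAverage μ π f v = ∫ x, inner ℂ (π x f) v • π x f ∂μ := by
  rw [orbitAverage, ContinuousLinearMap.integral_apply
    (integrable_of_continuous (continuous_rankOne_orbit hπ f))]
  rfl

theorem inner_orbitAverage (hπ : ∀ v, Continuous fun x => π x v) (f u v : H) :
    inner ℂ u (orbitAverage μ π f v) = ∫ x, inner ℂ (π x f) v * inner ℂ u (π x f) ∂μ := by
  have hc : Continuous fun x => inner ℂ (π x f) v • π x f :=
    ((hπ f).inner continuous_const).smul (hπ f)
  rw [orbitAverage_apply hπ, ← integral_inner (integrable_of_continuous hc)]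
  simp only [inner_smul_right]

/-- The compact operators form a closed convex set, and the integrand takes values of rank at most
one. -/
theorem isCompactOperator_orbitAverage (hπ : ∀ v, Continuous fun x => π x v) (f : H) :
    IsCompactOperator (orbitAverage μ π f) := by
  refine Convex.integral_mem (s := {T : H →L[ℂ] H | IsCompactOperator T}) ?_
    isClosed_setOfPred_isCompactOperator ?_
    (integrable_of_continuous (continuous_rankOne_orbit hπ f))
  · intro S hS T hT a b _ _ _
    exact (hS.smul a).add (hT.smul b)
  · refine Eventually.of_forall fun x => ?_
    exact (isCompactOperator_of_locallyCompactSpace_rng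
      (ContinuousLinearMap.toSpanSingleton ℂ (π x f))).comp_clm (innerSL ℂ (π x f))

theorem isSymmetric_orbitAverage (hπ : ∀ v, Continuous fun x => π x v) (f : H) :
    (orbitAverage μ π f).IsSymmetric := by
  intro u v
  change inner ℂ (orbitAverage μ π f u) v = inner ℂ u (orbitAverage μ π f v)
  rw [← inner_conj_symm, inner_orbitAverage hπ, inner_orbitAverage hπ, ← integral_conj]
  simp only [map_mul, inner_conj_symm]
  exact integral_congr_ae (Eventually.of_forall fun x => mul_comm _ _)

/-- ⟨f, Af⟩ = ∫ |⟨π(x)f, f⟩|² dx is positive: the integrand is continuous and nonzero at x = 1. -/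
theorem orbitAverage_ne_zero [μ.IsOpenPosMeasure] (hπ : ∀ v, Continuous fun x => π x v) {f : H}
    (hf : f ≠ 0) : orbitAverage μ π f ≠ 0 := by
  intro h0
  have h := inner_orbitAverage (μ := μ) hπ f f f
  have hc : Continuous fun x => ‖inner ℂ (π x f) f‖ ^ 2 :=
    ((hπ f).inner continuous_const).norm.pow 2
  have h1 : ∀ x, inner ℂ (π x f) f * inner ℂ f (π x f)
      = ((‖inner ℂ (π x f) f‖ ^ 2 : ℝ) : ℂ) := by
    intro x
    rw [← inner_conj_symm f (π x f), RCLike.mul_conj]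
    push_cast
    rfl
  simp only [h0, h1, integral_complex_ofReal] at h
  have h2 : (0 : ℝ) < ∫ x, ‖inner ℂ (π x f) f‖ ^ 2 ∂μ := by
    refine hc.integral_pos_of_hasCompactSupport_nonneg_nonzero
      (HasCompactSupport.of_compactSpace _) (fun x => by positivity) (x := 1) ?_
    simpa using hf
  simp only [zero_apply, inner_zero_right] at h
  exact h2.ne (by exact_mod_cast h)

/-- Substitute x ↦ zx and use that π(z) preserves inner products. -/
theorem orbitAverage_comm [ContinuousMul G] [μ.IsMulLeftInvariant]
    (hπ : ∀ v, Continuous fun x => π x v) (f v : H) (z : G) :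
    orbitAverage μ π f (π z v) = π z (orbitAverage μ π f v) := by
  have hc : Continuous fun x => inner ℂ (π x f) v • π x f :=
    ((hπ f).inner continuous_const).smul (hπ f)
  have h := (π z).toContinuousLinearEquiv.toContinuousLinearMap.integral_comp_comm
    (integrable_of_continuous (μ := μ) hc)
  rw [orbitAverage_apply hπ, orbitAverage_apply hπ]
  refine Eq.trans ?_ h
  rw [← integral_mul_left_eq_self _ z]
  refine integral_congr_ae (Eventually.of_forall fun x => ?_)
  simp [map_mul]

theorem orbitAverage_mem (hπ : ∀ v, Continuous fun x => π x v) {W : Submodule ℂ H}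
    (hW : IsClosed (W : Set H)) (hinv : IsInvariant π W) {f : H} (hf : f ∈ W) (v : H) :
    orbitAverage μ π f v ∈ W := by
  have hc : Continuous fun x => inner ℂ (π x f) v • π x f :=
    ((hπ f).inner continuous_const).smul (hπ f)
  rw [orbitAverage_apply hπ]
  exact Convex.integral_mem (W.restrictScalars ℝ).convex hW
    (Eventually.of_forall fun x => W.smul_mem _ (hinv x f hf)) (integrable_of_continuous hc)

variable (μ) in
/-- A nonzero closed invariant subspace of a continuous unitary representation of a compact group
contains a nonzero finite-dimensional invariant subspace. -/
theorem exists_finiteDimensional_invariant [ContinuousMul G] [μ.IsMulLeftInvariant]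
    [μ.IsOpenPosMeasure] (hπ : ∀ v, Continuous fun x => π x v) {W : Submodule ℂ H}
    (hW : IsClosed (W : Set H)) (hinv : IsInvariant π W) (hne : W ≠ ⊥) :
    ∃ E ≤ W, E ≠ ⊥ ∧ FiniteDimensional ℂ E ∧ IsInvariant π E := by
  obtain ⟨f, hf, hf0⟩ := W.exists_mem_ne_zero_of_ne_bot hne
  have hA := orbitAverage_ne_zero (μ := μ) hπ hf0
  have hcomp := isCompactOperator_orbitAverage (μ := μ) hπ f
  have hev := (ContinuousLinearMap.eq_zero_of_forall_hasEigenvalue_eq_zero hcomp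
    (isSymmetric_orbitAverage hπ f)).not.mpr hA
  push Not at hev
  obtain ⟨c, hc, hc0⟩ := hev
  -- The subspace is the eigenspace of c. It lies in W because v = c⁻¹Av, and it is invariant
  -- because A commutes with π.
  refine ⟨_, ?_, hc, ContinuousLinearMap.finite_dimensional_eigenspace hcomp c hc0, ?_⟩
  · intro v hv
    have hv : orbitAverage μ π f v = c • v := mem_eigenspace_iff.mp hv
    have := W.smul_mem c⁻¹ (orbitAverage_mem (μ := μ) hπ hW hinv hf v)
    rwa [hv, inv_smul_smul₀ hc0] at this
  · intro x v hv
    have hv : orbitAverage μ π f v = c • v := mem_eigenspace_iff.mp hv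
    refine mem_eigenspace_iff.mpr ?_
    change orbitAverage μ π f (π x v) = c • π x v
    rw [orbitAverage_comm hπ, hv, map_smul]

omit [CompleteSpace H] [TopologicalSpace G] [CompactSpace G] [MeasurableSpace G] [BorelSpace G] in
-- Descent on dimension: if E is not minimal, a proper nonzero invariant subspace has smaller
-- dimension.
theorem exists_minimal_invariant {E : Submodule ℂ H} (hE : E ≠ ⊥) [FiniteDimensional ℂ E]
    (hinv : IsInvariant π E) :
    ∃ F ≤ E, F ≠ ⊥ ∧ IsInvariant π F ∧ ∀ F' ≤ F, IsInvariant π F' → F' = ⊥ ∨ F' = F := by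
  induction hn : Module.finrank ℂ E using Nat.strong_induction_on generalizing E with
  | _ n ih =>
    by_cases h : ∀ F' ≤ E, IsInvariant π F' → F' = ⊥ ∨ F' = E
    · exact ⟨E, le_rfl, hE, hinv, h⟩
    · push Not at h
      obtain ⟨F', hle, hF', hb, hne⟩ := h
      have hlt : F' < E := lt_of_le_of_ne hle hne
      have : FiniteDimensional ℂ F' := Submodule.finiteDimensional_of_le hle
      obtain ⟨F, hF, h'⟩ := ih _ (hn ▸ Submodule.finrank_lt_finrank_of_lt hlt) hb hF' rfl
      exact ⟨F, hF.trans hle, h'⟩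

omit [CompleteSpace H] [CompactSpace G] [MeasurableSpace G] [BorelSpace G] in
/-- The restriction of a unitary representation to a finite-dimensional minimal invariant
subspace, written in matrix form. -/
theorem exists_unitaryIrrep_of_minimal (hπ : ∀ v, Continuous fun x => π x v)
    {F : Submodule ℂ H} [FiniteDimensional ℂ F] (hF : F ≠ ⊥) (hinv : IsInvariant π F)
    (hmin : ∀ F' ≤ F, IsInvariant π F' → F' = ⊥ ∨ F' = F) :
    ∃ (ξ : UnitaryIrrep G) (b : OrthonormalBasis (Fin ξ.dim) ℂ F),
      ∀ x j, π x (b j) = ∑ i, ξ.mat x i j • (b i : H) := by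
  let b := stdOrthonormalBasis ℂ F
  set d := Module.finrank ℂ F
  let M : G → Matrix (Fin d) (Fin d) ℂ := fun x => Matrix.of fun i j => inner ℂ (b i : H) (π x (b j))
  have hM : ∀ x j, π x (b j) = ∑ i, M x i j • (b i : H) := by
    intro x j
    have h := b.sum_repr' ⟨π x (b j), hinv x _ (b j).2⟩
    have h' := congrArg F.subtype h
    rw [map_sum] at h'
    exact h'.symm
  have hinner : ∀ i j, inner ℂ (b i : H) (b j : H) = if i = j then (1 : ℂ) else 0 := fun i j => by
    rw [← Submodule.coe_inner]; exact orthonormal_iff_ite.mp b.orthonormal i j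
  have h1 : M 1 = 1 := by
    ext i j
    simp [M, hinner, Matrix.one_apply]
  have hmul : ∀ x y, M (x * y) = M x * M y := by
    intro x y
    ext i j
    have : π (x * y) (b j) = π x (π y (b j)) := by simp
    simp only [Matrix.mul_apply]
    change inner ℂ (b i : H) (π (x * y) (b j)) = _
    rw [this, hM y j, map_sum, inner_sum]
    refine Finset.sum_congr rfl fun k _ => ?_
    rw [map_smul, inner_smul_right, mul_comm]
    rfl
  have hstar : ∀ x, (M x)ᴴ = M x⁻¹ := by
    intro x
    ext i j
    have : (π x⁻¹ (b j)) = (π x).symm (b j) := by simp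
    simp only [Matrix.conjTranspose_apply, M, Matrix.of_apply]
    rw [this, ← LinearIsometryEquiv.inner_map_eq_flip, RCLike.star_def, inner_conj_symm]
  have hu : ∀ x, M x ∈ Matrix.unitaryGroup (Fin d) ℂ := by
    intro x
    rw [Matrix.mem_unitaryGroup_iff, Matrix.star_eq_conjTranspose, hstar, ← hmul, mul_inv_cancel, h1]
  let ρ : G →* Matrix.unitaryGroup (Fin d) ℂ :=
    { toFun := fun x => ⟨M x, hu x⟩
      map_one' := Subtype.ext h1
      map_mul' := fun x y => Subtype.ext (hmul x y) }
  have hcont : Continuous ρ := by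
    refine Continuous.subtype_mk (continuous_matrix fun i j => ?_) _
    exact continuous_const.inner (hπ _)
  -- The injection `e` intertwines ρ with π and has range F, so subrepresentations of ρ become
  -- invariant subspaces of F, where minimality applies.
  let e : (Fin d → ℂ) →ₗ[ℂ] H := F.subtype ∘ₗ (b.toBasis.equivFun.symm : (Fin d → ℂ) →ₗ[ℂ] F)
  have he : ∀ v, e v = ∑ i, v i • (b i : H) := by
    intro v
    have h := congrArg F.subtype (b.toBasis.equivFun_symm_apply v)
    simp only [map_sum, map_smul, OrthonormalBasis.coe_toBasis] at h
    exact h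
  have heinj : Function.Injective e :=
    Subtype.val_injective.comp b.toBasis.equivFun.symm.injective
  have herange : LinearMap.range e = F := by
    simp [e, LinearMap.range_comp]
  have heπ : ∀ x v, π x (e v) = e (matrixRep ρ x v) := by
    intro x v
    have h2 : matrixRep ρ x v = M x *ᵥ v := rfl
    rw [h2, he, he, map_sum]
    simp only [map_smul, hM, Finset.smul_sum, Matrix.mulVec, dotProduct, Finset.sum_smul, smul_smul]
    rw [Finset.sum_comm]
    simp only [mul_comm]
  refine ⟨⟨d, ρ, hcont, ?_⟩, b, hM⟩
  have : Nontrivial (Subrepresentation (matrixRep ρ)) := by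
    refine ⟨⊥, ⊤, fun h => hF ?_⟩
    have h' : (⊥ : Submodule ℂ (Fin d → ℂ)) = ⊤ := congrArg Subrepresentation.toSubmodule h
    rw [← herange, LinearMap.range_eq_map, ← h', Submodule.map_bot]
  refine ⟨fun S => ?_⟩
  have hS := hmin (S.toSubmodule.map e) (herange ▸ LinearMap.map_le_range) (by
    rintro x _ ⟨v, hv, rfl⟩
    exact ⟨_, S.apply_mem_toSubmodule x hv, (heπ x v).symm⟩)
  rcases hS with h | h
  · left
    apply Subrepresentation.toSubmodule_injective
    change S.toSubmodule = ⊥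
    apply Submodule.map_injective_of_injective heinj
    rw [h, Submodule.map_bot]
  · right
    apply Subrepresentation.toSubmodule_injective
    change S.toSubmodule = ⊤
    apply Submodule.map_injective_of_injective heinj
    rw [h, ← LinearMap.range_eq_map, herange]

end UnitaryRepresentation

/-! ### Schur's lemma and the orthogonality relations -/

namespace UnitaryIrrep

variable {G : Type*} [Group G] [TopologicalSpace G]

theorem mat_one (ξ : UnitaryIrrep G) : ξ.mat 1 = 1 := by simp [mat]

theorem mat_mul (ξ : UnitaryIrrep G) (x y : G) : ξ.mat (x * y) = ξ.mat x * ξ.mat y := by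
  simp [mat]

theorem mat_inv (ξ : UnitaryIrrep G) (x : G) : ξ.mat x⁻¹ = (ξ.mat x)ᴴ := by
  have h : ξ.toHom x⁻¹ = star (ξ.toHom x) := by rw [map_inv]; rfl
  simp [mat, h, Matrix.star_eq_conjTranspose]

theorem continuous_mat (ξ : UnitaryIrrep G) (i j : Fin ξ.dim) : Continuous fun x => ξ.mat x i j :=
  (continuous_subtype_val.comp ξ.continuous_toHom).matrix_elem i j

theorem dim_pos (ξ : UnitaryIrrep G) : 0 < ξ.dim := by
  by_contra h
  obtain ⟨d, ρ, hc, hirr⟩ := ξ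
  obtain rfl : d = 0 := by simpa using h
  obtain ⟨S, S', hne⟩ := hirr.toNontrivial
  exact hne (Subrepresentation.toSubmodule_injective (Subsingleton.elim _ _))

/-- The linear intertwining map attached to a matrix which intertwines two representations. -/
def intertwiningMap {ξ η : UnitaryIrrep G} (B : Matrix (Fin ξ.dim) (Fin η.dim) ℂ)
    (hB : ∀ x, ξ.mat x * B = B * η.mat x) :
    Representation.IntertwiningMap (matrixRep η.toHom) (matrixRep ξ.toHom) where
  toLinearMap := Matrix.toLin' B
  isIntertwining' x := by
    change Matrix.toLin' B ∘ₗ Matrix.toLin' (η.mat x) = Matrix.toLin' (ξ.mat x) ∘ₗ Matrix.toLin' B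
    rw [← Matrix.toLin'_mul, ← Matrix.toLin'_mul, hB]

/-- **Schur's lemma** for a self-intertwining matrix. -/
theorem exists_eq_smul_one {ξ : UnitaryIrrep G} (B : Matrix (Fin ξ.dim) (Fin ξ.dim) ℂ)
    (hB : ∀ x, ξ.mat x * B = B * ξ.mat x) : ∃ c : ℂ, B = c • (1 : Matrix _ _ ℂ) := by
  have := ξ.irreducible
  obtain ⟨c, hc⟩ := (Representation.IsIrreducible.algebraMap_intertwiningMap_bijective_of_isAlgClosed
    (ρ := matrixRep ξ.toHom)).surjective (intertwiningMap B hB)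
  refine ⟨c, Matrix.toLin'.injective ?_⟩
  have h := congrArg Representation.IntertwiningMap.toLinearMap hc
  refine h.symm.trans ?_
  rw [map_smul, Matrix.toLin'_one]
  rfl

open scoped ComplexOrder in
/-- **Schur's lemma** for inequivalent representations. -/
theorem eq_zero_of_not_equivalent {ξ η : UnitaryIrrep G} (h : ¬ Equivalent ξ η)
    (B : Matrix (Fin ξ.dim) (Fin η.dim) ℂ) (hB : ∀ x, ξ.mat x * B = B * η.mat x) : B = 0 := by
  have hB' : ∀ x, η.mat x * Bᴴ = Bᴴ * ξ.mat x := by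
    intro x
    have := congrArg Matrix.conjTranspose (hB x⁻¹)
    simpa [Matrix.conjTranspose_mul, mat_inv] using this.symm
  -- Both BBᴴ and BᴴB are self-intertwiners, hence scalar. If B ≠ 0, the scalars agree and are
  -- positive, so a rescaled B would be a unitary equivalence.
  obtain ⟨c, hc⟩ := exists_eq_smul_one (B * Bᴴ) fun x => by
    rw [← Matrix.mul_assoc, hB, Matrix.mul_assoc, hB', Matrix.mul_assoc]
  obtain ⟨c', hc'⟩ := exists_eq_smul_one (Bᴴ * B) fun x => by
    rw [← Matrix.mul_assoc, hB', Matrix.mul_assoc, hB, Matrix.mul_assoc]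
  by_contra hne
  have hBB : B * Bᴴ ≠ 0 := Matrix.self_mul_conjTranspose_eq_zero.not.mpr hne
  have hcc : c = c' := by
    have h1 : (c - c') • B = 0 := by
      rw [sub_smul, sub_eq_zero]
      calc c • B = (B * Bᴴ) * B := by rw [hc, Matrix.smul_mul, Matrix.one_mul]
        _ = c' • B := by rw [Matrix.mul_assoc, hc', Matrix.mul_smul, Matrix.mul_one]
    exact sub_eq_zero.mp ((smul_eq_zero.mp h1).resolve_right hne)
  have hc0 : 0 ≤ c := by
    have h1 := (Matrix.posSemidef_self_mul_conjTranspose B).diag_nonneg (i := ⟨0, ξ.dim_pos⟩)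
    rw [hc] at h1
    simpa using h1
  have hcne : c ≠ 0 := by
    rintro rfl
    exact hBB (by rw [hc, zero_smul])
  obtain ⟨r, hr, rfl⟩ : ∃ r : ℝ, 0 ≤ r ∧ (r : ℂ) = c :=
    ⟨c.re, (Complex.le_def.mp hc0).1, Complex.ext rfl (Complex.le_def.mp hc0).2⟩
  -- The scalar s = r^{-1/2} makes sB unitary.
  obtain ⟨s, hs⟩ : ∃ s : ℝ, (s : ℂ) * s * r = 1 := by
    refine ⟨(Real.sqrt r)⁻¹, ?_⟩
    rw [← Complex.ofReal_mul, ← mul_inv, Real.mul_self_sqrt hr, Complex.ofReal_inv,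
      inv_mul_cancel₀ hcne]
  refine h ⟨(s : ℂ) • B, ?_, ?_, fun x => ?_⟩
  · rw [Matrix.conjTranspose_smul, Matrix.smul_mul, Matrix.mul_smul, hc, smul_smul, smul_smul]
    simp [hs]
  · rw [Matrix.conjTranspose_smul, Matrix.smul_mul, Matrix.mul_smul, hc', ← hcc, smul_smul,
      smul_smul]
    simp [hs]
  · rw [Matrix.mul_smul, hB, Matrix.smul_mul]

variable [CompactSpace G] [IsTopologicalGroup G] [MeasurableSpace G] [BorelSpace G]
  {μ : Measure G} [IsProbabilityMeasure μ] [μ.IsMulLeftInvariant]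

omit [CompactSpace G] [IsTopologicalGroup G] [MeasurableSpace G] [BorelSpace G] in
theorem continuous_mat_mul_star (ξ η : UnitaryIrrep G) (i j : Fin ξ.dim) (k l : Fin η.dim) :
    Continuous fun x => ξ.mat x i j * star (η.mat x k l) :=
  (ξ.continuous_mat i j).mul (η.continuous_mat k l).star

/-- The matrix `∫ ξ(x) E_{jl} η(x)^*` with entries `∫ ξ_{ij} conj η_{kl}` intertwines. -/
theorem integral_mat_intertwines (ξ η : UnitaryIrrep G) (j : Fin ξ.dim) (l : Fin η.dim) (z : G) :
    ξ.mat z * (Matrix.of fun i k => ∫ x, ξ.mat x i j * star (η.mat x k l) ∂μ)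
      = (Matrix.of fun i k => ∫ x, ξ.mat x i j * star (η.mat x k l) ∂μ) * η.mat z := by
  ext i k
  have hl : (ξ.mat z * (Matrix.of fun i k => ∫ x, ξ.mat x i j * star (η.mat x k l) ∂μ)) i k
      = ∫ x, ξ.mat (z * x) i j * star (η.mat x k l) ∂μ := by
    simp only [Matrix.mul_apply, Matrix.of_apply, mat_mul, Finset.sum_mul, mul_assoc]
    rw [integral_finsetSum]
    · simp only [integral_const_mul]
    · exact fun m _ => (integrable_of_continuous (continuous_mat_mul_star ξ η m j k l)).const_mul _
  have hr : ((Matrix.of fun i k => ∫ x, ξ.mat x i j * star (η.mat x k l) ∂μ) * η.mat z) i k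
      = ∫ x, ξ.mat x i j * star (η.mat (z⁻¹ * x) k l) ∂μ := by
    simp only [Matrix.mul_apply, Matrix.of_apply, mat_mul, mat_inv, Matrix.conjTranspose_apply,
      star_sum, star_mul', star_star, Finset.mul_sum]
    rw [integral_finsetSum]
    · refine Finset.sum_congr rfl fun m _ => ?_
      rw [← integral_mul_const]
      exact integral_congr_ae (Eventually.of_forall fun x => by dsimp only; ring)
    · intro m _
      refine ((integrable_of_continuous (continuous_mat_mul_star ξ η i j m l)).const_mul
        (η.mat z m k)).congr (Eventually.of_forall fun x => by dsimp only; ring)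
  rw [hl, hr, ← integral_mul_left_eq_self _ z⁻¹]
  simp only [mul_inv_cancel_left]

/-- Matrix coefficients of inequivalent representations are orthogonal. -/
theorem integral_mat_mul_star_of_not_equivalent {ξ η : UnitaryIrrep G} (h : ¬ Equivalent ξ η)
    (i j : Fin ξ.dim) (k l : Fin η.dim) : ∫ x, ξ.mat x i j * star (η.mat x k l) ∂μ = 0 :=
  congrFun (congrFun (eq_zero_of_not_equivalent h _ (integral_mat_intertwines ξ η j l)) i) k

/-- The **Schur orthogonality relations** within one irreducible representation. -/
theorem integral_mat_mul_star_self [μ.IsInvInvariant] (ξ : UnitaryIrrep G) (i j k l : Fin ξ.dim) :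
    ∫ x, ξ.mat x i j * star (ξ.mat x k l) ∂μ
      = if i = k ∧ j = l then ((ξ.dim : ℂ))⁻¹ else 0 := by
  choose c hc using fun j l : Fin ξ.dim =>
    exists_eq_smul_one _ (integral_mat_intertwines (μ := μ) ξ ξ j l)
  have hc' : ∀ i j k l, ∫ x, ξ.mat x i j * star (ξ.mat x k l) ∂μ = if i = k then c j l else 0 := by
    intro i j k l
    have := congrFun (congrFun (hc j l) i) k
    simpa [Matrix.one_apply] using this
  -- Inversion exchanges the row and column indices, so the Kronecker delta that Schur's lemma gives
  -- for rows also holds for columns.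
  have hinv : ∀ i j k l, ∫ x, ξ.mat x i j * star (ξ.mat x k l) ∂μ
      = ∫ x, ξ.mat x l k * star (ξ.mat x j i) ∂μ := by
    intro i j k l
    rw [← integral_inv_eq_self]
    refine integral_congr_ae (Eventually.of_forall fun x => ?_)
    simp [mat_inv, mul_comm]
  have hoff : ∀ j l, j ≠ l → c j l = 0 := by
    intro j l hjl
    have h1 := hinv j j j l
    rw [hc', hc', if_pos rfl, if_neg hjl.symm] at h1
    exact h1
  -- The columns of ξ(x) are unit vectors; integrating this gives d_ξ c_{jj} = 1 and fixes the
  -- constant.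
  have hsum : ∀ j, ∑ i, ∫ x, ξ.mat x i j * star (ξ.mat x i j) ∂μ = 1 := by
    intro j
    rw [← integral_finsetSum _ fun i _ =>
      integrable_of_continuous (continuous_mat_mul_star ξ ξ i j i j)]
    have : ∀ x, ∑ i, ξ.mat x i j * star (ξ.mat x i j) = 1 := by
      intro x
      have h1 : (ξ.mat x)ᴴ * ξ.mat x = 1 := by rw [← mat_inv, ← mat_mul, inv_mul_cancel, mat_one]
      have h2 := congrFun (congrFun h1 j) j
      rw [Matrix.mul_apply, Matrix.one_apply_eq] at h2
      rw [← h2]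
      exact Finset.sum_congr rfl fun i _ => mul_comm _ _
    rw [integral_congr_ae (Eventually.of_forall this)]
    simp
  have hdiag : ∀ j, c j j = (ξ.dim : ℂ)⁻¹ := by
    intro j
    have h1 := hsum j
    simp only [hc', if_true, Finset.sum_const, Finset.card_univ, Fintype.card_fin, nsmul_eq_mul]
      at h1
    exact eq_inv_of_mul_eq_one_right h1
  rw [hc']
  by_cases hik : i = k
  · by_cases hjl : j = l
    · subst hjl; simp [hik, hdiag]
    · simp [hik, hjl, hoff j l hjl]
  · simp [hik]

end UnitaryIrrep

/-! ### Right and inversion invariance of Haar measure -/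

section Unimodular

variable {G : Type*} [Group G] [TopologicalSpace G] [IsTopologicalGroup G] [CompactSpace G]
  [MeasurableSpace G] [BorelSpace G] (μ : Measure G) [μ.IsHaarMeasure]
  [IsProbabilityMeasure μ]

/-- A right translate of μ is again a Haar probability measure, so uniqueness applies. -/
theorem isMulRightInvariant_of_compactSpace : μ.IsMulRightInvariant where
  map_mul_right_eq_self g := by
    have : IsProbabilityMeasure (μ.map (· * g)) :=
      Measure.isProbabilityMeasure_map (measurable_mul_const g).aemeasurable
    exact Measure.isHaarMeasure_eq_of_isProbabilityMeasure _ _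

theorem isInvInvariant_of_compactSpace : μ.IsInvInvariant where
  inv_eq_self := by
    -- Right invariance of μ is what makes `μ.inv` left invariant.
    have := isMulRightInvariant_of_compactSpace μ
    have : IsProbabilityMeasure μ.inv := Measure.isProbabilityMeasure_map measurable_inv.aemeasurable
    have : μ.inv.IsHaarMeasure := {}
    exact Measure.isHaarMeasure_eq_of_isProbabilityMeasure _ _

end Unimodular

/-! ### The right regular representation -/

section Translation

variable {G : Type*} [Group G] [MeasurableSpace G] [MeasurableMul G]

/-- Right translation `f ↦ f(· x)` on `L²(G)` as a unitary representation of `G`. -/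
def rightTranslation (μ : Measure G) [μ.IsMulRightInvariant] : G →* (Lp ℂ 2 μ ≃ₗᵢ[ℂ] Lp ℂ 2 μ) where
  toFun x :=
    -- `MulOpposite` and `DomMulAct` each reverse multiplication; the reversals cancel, leaving a
    -- homomorphism in x.
    { toFun := fun f => DomMulAct.mk (MulOpposite.op x) • f
      invFun := fun f => DomMulAct.mk (MulOpposite.op x⁻¹) • f
      left_inv := fun f => by simp [smul_smul]
      right_inv := fun f => by simp [smul_smul]
      map_add' := fun f g => smul_add _ f g
      map_smul' := fun c f => (smul_comm c (DomMulAct.mk (MulOpposite.op x)) f).symm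
      norm_map' := fun f => DomMulAct.norm_smul_Lp _ f }
  map_one' := by ext1 f; exact one_smul (DomMulAct Gᵐᵒᵖ) f
  map_mul' x y := by
    ext1 f
    exact (smul_smul (DomMulAct.mk (MulOpposite.op x)) (DomMulAct.mk (MulOpposite.op y)) f).symm

variable {μ : Measure G} [μ.IsMulRightInvariant]

theorem rightTranslation_ae_eq (x : G) (f : Lp ℂ 2 μ) :
    rightTranslation μ x f =ᵐ[μ] fun y => f (y * x) :=
  DomMulAct.smul_Lp_ae_eq (DomMulAct.mk (MulOpposite.op x)) f

theorem continuous_rightTranslation [TopologicalSpace G] [IsTopologicalGroup G] [BorelSpace G]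
    [CompactSpace G] [SecondCountableTopology G] [IsFiniteMeasure μ] [μ.Regular] (f : Lp ℂ 2 μ) :
    Continuous fun x => rightTranslation μ x f := by
  have : Fact ((2 : ENNReal) ≠ ⊤) := ⟨by simp⟩
  let : MeasurableSpace Gᵐᵒᵖ := borel _
  have : BorelSpace Gᵐᵒᵖ := ⟨rfl⟩
  change Continuous fun x => DomMulAct.mk (MulOpposite.op x) • f
  exact (DomMulAct.continuous_mk.comp MulOpposite.continuous_op).smul continuous_const

end Translation

/-! ### Matrix coefficients and the Peter–Weyl theorem -/

section PeterWeyl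

variable {G : Type*} [Group G] [TopologicalSpace G] [CompactSpace G]
  [MeasurableSpace G] [BorelSpace G]

/-- The matrix coefficient `x ↦ ξ(x)_{ij}` as an element of `L²(G)`. -/
def coeff (μ : Measure G) [IsFiniteMeasure μ] (ξ : UnitaryIrrep G) (i j : Fin ξ.dim) : Lp ℂ 2 μ :=
  ContinuousMap.toLp 2 μ ℂ ⟨fun x => ξ.mat x i j, ξ.continuous_mat i j⟩

variable (μ : Measure G) [IsProbabilityMeasure μ]

theorem coeff_ae_eq (ξ : UnitaryIrrep G) (i j : Fin ξ.dim) :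
    coeff μ ξ i j =ᵐ[μ] fun x => ξ.mat x i j :=
  ContinuousMap.coeFn_toLp (p := 2) (𝕜 := ℂ) μ ⟨fun x => ξ.mat x i j, ξ.continuous_mat i j⟩

theorem sum_smul_coeff_ae_eq {ι : Type*} (s : Finset ι) (c : ι → ℂ) (ξ : UnitaryIrrep G)
    (i j : ι → Fin ξ.dim) :
    (∑ a ∈ s, c a • coeff μ ξ (i a) (j a) : Lp ℂ 2 μ) =ᵐ[μ]
      fun x => ∑ a ∈ s, c a * ξ.mat x (i a) (j a) := by
  have h : (∑ a ∈ s, c a • coeff μ ξ (i a) (j a) : Lp ℂ 2 μ) = ContinuousMap.toLp 2 μ ℂ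
      (∑ a ∈ s, c a • ⟨fun x => ξ.mat x (i a) (j a), ξ.continuous_mat (i a) (j a)⟩) := by
    simp only [map_sum, map_smul]; rfl
  rw [h]
  refine (ContinuousMap.coeFn_toLp (p := 2) (𝕜 := ℂ) μ _).trans (Eventually.of_forall fun x => ?_)
  simp

theorem inner_coeff_coeff (ξ η : UnitaryIrrep G) (i j : Fin ξ.dim) (k l : Fin η.dim) :
    inner ℂ (coeff μ ξ i j) (coeff μ η k l) = ∫ x, η.mat x k l * star (ξ.mat x i j) ∂μ := by
  rw [L2.inner_def]
  refine integral_congr_ae ?_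
  filter_upwards [coeff_ae_eq μ ξ i j, coeff_ae_eq μ η k l] with x h1 h2
  rw [h1, h2]
  rfl

theorem inner_coeff_toLp (ξ : UnitaryIrrep G) (i j : Fin ξ.dim) {f : G → ℂ} (hf : MemLp f 2 μ) :
    inner ℂ (coeff μ ξ i j) (hf.toLp f) = fourier μ f ξ j i := by
  rw [L2.inner_def]
  refine integral_congr_ae ?_
  filter_upwards [coeff_ae_eq μ ξ i j, hf.coeFn_toLp] with x h1 h2
  rw [h1, h2]
  rfl

/-- The linear span of all matrix coefficients of irreducible unitary representations. -/
def coeffSpan : Submodule ℂ (Lp ℂ 2 μ) :=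
  Submodule.span ℂ {f | ∃ (ξ : UnitaryIrrep G) (i j : Fin ξ.dim), f = coeff μ ξ i j}

theorem coeff_mem_coeffSpan (ξ : UnitaryIrrep G) (i j : Fin ξ.dim) :
    coeff μ ξ i j ∈ coeffSpan μ :=
  Submodule.subset_span ⟨ξ, i, j, rfl⟩

variable [IsTopologicalGroup G]

theorem rightTranslation_coeff [μ.IsMulRightInvariant] (x : G) (ξ : UnitaryIrrep G)
    (i j : Fin ξ.dim) :
    rightTranslation μ x (coeff μ ξ i j) = ∑ k, ξ.mat x k j • coeff μ ξ i k := by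
  refine Lp.ext ?_
  filter_upwards [rightTranslation_ae_eq x (coeff μ ξ i j),
    sum_smul_coeff_ae_eq μ Finset.univ (fun k => ξ.mat x k j) ξ (fun _ => i) fun k => k,
    (eventually_mul_right_iff μ x).mpr (coeff_ae_eq μ ξ i j)] with y h1 h2 h3
  rw [h1, h2, h3, UnitaryIrrep.mat_mul, Matrix.mul_apply]
  exact Finset.sum_congr rfl fun k _ => mul_comm _ _

/-- Translation by x is unitary with adjoint translation by x⁻¹, and the latter preserves the span
of the coefficients. -/
theorem isInvariant_orthogonal_coeffSpan [μ.IsMulRightInvariant] :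
    IsInvariant (rightTranslation μ) (coeffSpan μ)ᗮ := by
  intro x v hv
  rw [coeffSpan, Submodule.mem_orthogonal]
  intro u hu
  induction hu using Submodule.span_induction with
  | mem u hu =>
    obtain ⟨ξ, i, j, rfl⟩ := hu
    have h : inner ℂ (rightTranslation μ x⁻¹ (coeff μ ξ i j)) v = 0 := by
      rw [rightTranslation_coeff, sum_inner]
      refine Finset.sum_eq_zero fun k _ => ?_
      rw [inner_smul_left, (Submodule.mem_orthogonal _ _).mp hv _ (coeff_mem_coeffSpan μ ξ i k),
        mul_zero]
    rw [← LinearIsometryEquiv.inner_map_map (rightTranslation μ x⁻¹)]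
    have hv' : rightTranslation μ x⁻¹ (rightTranslation μ x v) = v := by simp
    rwa [hv']
  | zero => exact inner_zero_left _
  | add u w _ _ hu hw => rw [inner_add_left, hu, hw, add_zero]
  | smul c u _ hu => rw [inner_smul_left, hu, mul_zero]

/-- A vector of `L²(G)` which transforms under right translations by the matrices of an
irreducible representation is a combination of matrix coefficients. -/
theorem mem_coeffSpan_of_transforms [SecondCountableTopology G] [μ.IsMulLeftInvariant]
    [μ.IsMulRightInvariant] (ξ : UnitaryIrrep G) (b : Fin ξ.dim → Lp ℂ 2 μ)
    (hb : ∀ x j, rightTranslation μ x (b j) = ∑ i, ξ.mat x i j • b i) (j : Fin ξ.dim) :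
    b j ∈ coeffSpan μ := by
  have hmeas : ∀ i, Measurable (b i : G → ℂ) := fun i => (Lp.stronglyMeasurable (b i)).measurable
  have h1 : ∀ x, ∀ᵐ y ∂μ, b j (y * x) = ∑ i, ξ.mat x i j * b i y := by
    intro x
    have h2 : (rightTranslation μ x (b j) : G → ℂ) =ᵐ[μ] fun y => ∑ i, ξ.mat x i j * b i y := by
      rw [hb]
      refine (Lp.coeFn_finsetSum _ _).trans ?_
      have : ∀ᵐ y ∂μ, ∀ i, (ξ.mat x i j • b i : Lp ℂ 2 μ) y = ξ.mat x i j * b i y :=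
        ae_all_iff.mpr fun i => Lp.coeFn_smul _ _
      filter_upwards [this] with y hy
      simp [hy]
    exact (rightTranslation_ae_eq x (b j)).symm.trans h2
  have hset : MeasurableSet {p : G × G | b j (p.2 * p.1) = ∑ i, ξ.mat p.1 i j * b i p.2} := by
    refine measurableSet_eq_fun ((hmeas j).comp (measurable_snd.mul measurable_fst)) ?_
    exact Finset.measurable_sum _ fun i _ =>
      ((ξ.continuous_mat i j).measurable.comp measurable_fst).mul ((hmeas i).comp measurable_snd)
  -- By Fubini the relation, known for each x and a.e. y, holds for a.e. y and a.e. x. One good y is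
  -- fixed, so the values b_i(y) become constants.
  obtain ⟨y, hy⟩ := ((Measure.ae_ae_comm (μ := μ) (ν := μ) hset).mp
    (Eventually.of_forall h1)).exists
  have h3 := (eventually_mul_left_iff μ y⁻¹).mpr hy
  -- With z = yx the relation reads b_j(z) = ∑_i ξ_{ij}(y⁻¹z) b_i(y); expanding ξ(y⁻¹z) = ξ(y⁻¹)ξ(z)
  -- yields the coefficients.
  have h4 : b j = ∑ k, (∑ i, ξ.mat y⁻¹ i k * b i y) • coeff μ ξ k j := by
    refine Lp.ext ?_
    filter_upwards [h3, sum_smul_coeff_ae_eq μ Finset.univ (fun k => ∑ i, ξ.mat y⁻¹ i k * b i y) ξ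
      (fun k => k) fun _ => j] with z hz1 hz2
    rw [hz2]
    rw [mul_inv_cancel_left] at hz1
    rw [hz1]
    simp only [UnitaryIrrep.mat_mul, Matrix.mul_apply, Finset.sum_mul]
    rw [Finset.sum_comm]
    refine Finset.sum_congr rfl fun _ _ => Finset.sum_congr rfl fun _ _ => ?_
    ring
  rw [h4]
  exact Submodule.sum_mem _ fun k _ => Submodule.smul_mem _ _ (coeff_mem_coeffSpan μ ξ k j)

/-- The **Peter–Weyl theorem**: matrix coefficients span a dense subspace of `L²(G)`. -/
theorem orthogonal_coeffSpan_eq_bot [SecondCountableTopology G] [μ.IsHaarMeasure]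
    [μ.IsMulRightInvariant] : (coeffSpan μ)ᗮ = ⊥ := by
  by_contra hne
  obtain ⟨E, hEW, hE, hfin, hEinv⟩ := exists_finiteDimensional_invariant μ
    (continuous_rightTranslation (μ := μ)) (Submodule.isClosed_orthogonal _)
    (isInvariant_orthogonal_coeffSpan μ) hne
  obtain ⟨F, hFE, hF, hFinv, hmin⟩ := exists_minimal_invariant hE hEinv
  have : FiniteDimensional ℂ F := Submodule.finiteDimensional_of_le hFE
  obtain ⟨ξ, b, hb⟩ := exists_unitaryIrrep_of_minimal
    (continuous_rightTranslation (μ := μ)) hF hFinv hmin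
  let j : Fin ξ.dim := ⟨0, ξ.dim_pos⟩
  -- A basis vector of F lies both in the span and in its orthogonal complement, so it vanishes.
  have h1 := mem_coeffSpan_of_transforms μ ξ (fun j => (b j : Lp ℂ 2 μ)) hb j
  have h2 := hEW (hFE (b j).2)
  have h3 : (b j : Lp ℂ 2 μ) = 0 := inner_self_eq_zero.mp ((Submodule.mem_orthogonal _ _).mp h2 _ h1)
  exact b.orthonormal.ne_zero j (Subtype.ext h3)

end PeterWeyl

/-! ### Fourier series in L²(G) -/

section FourierSeries

variable {G : Type*} [Group G] [TopologicalSpace G] [CompactSpace G]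
  [MeasurableSpace G] [BorelSpace G] (μ : Measure G) [IsProbabilityMeasure μ]

/-- Matrix coefficients of a representation are combinations of those of an equivalent one. -/
theorem coeff_mem_span_of_equivalent {ξ η : UnitaryIrrep G} (h : ξ.Equivalent η)
    (i j : Fin ξ.dim) :
    coeff μ ξ i j ∈ Submodule.span ℂ
      (Set.range fun p : Fin η.dim × Fin η.dim => coeff μ η p.1 p.2) := by
  obtain ⟨U, hU, -, hint⟩ := h
  have hmat : ∀ x, ξ.mat x i j = ∑ p : Fin η.dim × Fin η.dim,
      (U i p.1 * star (U j p.2)) * η.mat x p.1 p.2 := by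
    intro x
    have : ξ.mat x = U * η.mat x * Uᴴ := by
      rw [← hint, Matrix.mul_assoc, hU, Matrix.mul_one]
    rw [this, Fintype.sum_prod_type]
    simp only [Matrix.mul_apply, Finset.sum_mul, Matrix.conjTranspose_apply]
    rw [Finset.sum_comm]
    refine Finset.sum_congr rfl fun _ _ => Finset.sum_congr rfl fun _ _ => ?_
    ring
  have h1 : coeff μ ξ i j = ∑ p : Fin η.dim × Fin η.dim,
      (U i p.1 * star (U j p.2)) • coeff μ η p.1 p.2 := by
    refine Lp.ext ?_
    filter_upwards [coeff_ae_eq μ ξ i j, sum_smul_coeff_ae_eq μ Finset.univ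
      (fun p : Fin η.dim × Fin η.dim => U i p.1 * star (U j p.2)) η Prod.fst Prod.snd]
      with x h2 h3
    rw [h2, h3, hmat]
  rw [h1]
  exact Submodule.sum_mem _ fun p _ => Submodule.smul_mem _ _ (Submodule.subset_span ⟨p, rfl⟩)

/-- The indices of the matrix coefficients of a system of representatives. -/
abbrev CoeffIndex (rep : UnitaryDual G → UnitaryIrrep G) : Type _ :=
  Σ c : UnitaryDual G, Fin (rep c).dim × Fin (rep c).dim

/-- The normalized matrix coefficient `√d_ξ ξ_{ij}`. -/
def normalizedCoeff (rep : UnitaryDual G → UnitaryIrrep G) (a : CoeffIndex rep) : Lp ℂ 2 μ :=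
  (Real.sqrt (rep a.1).dim : ℂ) • coeff μ (rep a.1) a.2.1 a.2.2

variable [IsTopologicalGroup G] {rep : UnitaryDual G → UnitaryIrrep G}

open scoped Classical in
theorem inner_coeff_rep [μ.IsMulLeftInvariant] [μ.IsInvInvariant]
    (hrep : ∀ c : UnitaryDual G, (⟦rep c⟧ : UnitaryDual G) = c) (a b : CoeffIndex rep) :
    inner ℂ (coeff μ (rep a.1) a.2.1 a.2.2) (coeff μ (rep b.1) b.2.1 b.2.2)
      = if a = b then ((rep a.1).dim : ℂ)⁻¹ else 0 := by
  obtain ⟨c, i, j⟩ := a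
  obtain ⟨c', k, l⟩ := b
  rw [inner_coeff_coeff]
  by_cases hc : c = c'
  · subst hc
    rw [UnitaryIrrep.integral_mat_mul_star_self]
    simp [eq_comm]
  · rw [UnitaryIrrep.integral_mat_mul_star_of_not_equivalent, if_neg]
    · simp [hc]
    · intro h
      apply hc
      rw [← hrep c, ← hrep c']
      exact (Quotient.sound h).symm

theorem orthonormal_normalizedCoeff [μ.IsMulLeftInvariant] [μ.IsInvInvariant]
    (hrep : ∀ c : UnitaryDual G, (⟦rep c⟧ : UnitaryDual G) = c) :
    Orthonormal ℂ (normalizedCoeff μ rep) := by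
  classical
  rw [orthonormal_iff_ite]
  intro a b
  rw [normalizedCoeff, normalizedCoeff, inner_smul_left, inner_smul_right, inner_coeff_rep μ hrep]
  by_cases hab : a = b
  · subst hab
    have hd : ((rep a.1).dim : ℂ) ≠ 0 := by exact_mod_cast (rep a.1).dim_pos.ne'
    rw [if_pos rfl, if_pos rfl, Complex.conj_ofReal, ← mul_assoc, ← Complex.ofReal_mul,
      Real.mul_self_sqrt (Nat.cast_nonneg _), Complex.ofReal_natCast, mul_inv_cancel₀ hd]
  · simp [hab]

variable [SecondCountableTopology G] [μ.IsHaarMeasure] [μ.IsMulRightInvariant]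

/-- The chosen representatives suffice, because coefficients of any ξ are combinations of those of
the representative of its class. -/
theorem orthogonal_span_normalizedCoeff
    (hrep : ∀ c : UnitaryDual G, (⟦rep c⟧ : UnitaryDual G) = c) :
    (Submodule.span ℂ (Set.range (normalizedCoeff μ rep)))ᗮ = ⊥ := by
  rw [eq_bot_iff, ← orthogonal_coeffSpan_eq_bot μ]
  refine Submodule.orthogonal_le (Submodule.span_le.mpr ?_)
  rintro _ ⟨ξ, i, j, rfl⟩
  have heq : ξ.Equivalent (rep ⟦ξ⟧) := Quotient.exact (hrep ⟦ξ⟧).symm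
  refine Submodule.span_le.mpr ?_ (coeff_mem_span_of_equivalent μ heq i j)
  rintro _ ⟨p, rfl⟩
  have hd : (Real.sqrt (rep ⟦ξ⟧).dim : ℂ) ≠ 0 := by
    exact_mod_cast (Real.sqrt_pos.mpr (Nat.cast_pos.mpr (rep ⟦ξ⟧).dim_pos)).ne'
  have h := Submodule.smul_mem _ (Real.sqrt (rep ⟦ξ⟧).dim : ℂ)⁻¹
    (Submodule.subset_span (R := ℂ) (Set.mem_range_self (f := normalizedCoeff μ rep) ⟨⟦ξ⟧, p⟩))
  rwa [normalizedCoeff, inv_smul_smul₀ hd] at h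

variable [μ.IsInvInvariant]

/-- The Hilbert basis of `L²(G)` given by the normalized matrix coefficients. -/
def coeffBasis (hrep : ∀ c : UnitaryDual G, (⟦rep c⟧ : UnitaryDual G) = c) :
    HilbertBasis (CoeffIndex rep) ℂ (Lp ℂ 2 μ) :=
  HilbertBasis.mkOfOrthogonalEqBot (orthonormal_normalizedCoeff μ hrep)
    (orthogonal_span_normalizedCoeff μ hrep)

theorem coeffBasis_apply (hrep : ∀ c : UnitaryDual G, (⟦rep c⟧ : UnitaryDual G) = c)
    (a : CoeffIndex rep) : coeffBasis μ hrep a = normalizedCoeff μ rep a := by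
  rw [coeffBasis, HilbertBasis.coe_mkOfOrthogonalEqBot]

variable {μ}

/-- A square integrable function is determined by its Fourier transform. -/
theorem ae_eq_of_fourier_eq (hrep : ∀ c : UnitaryDual G, (⟦rep c⟧ : UnitaryDual G) = c)
    {f g : G → ℂ} (hf : MemLp f 2 μ) (hg : MemLp g 2 μ)
    (h : ∀ c, fourier μ f (rep c) = fourier μ g (rep c)) : f =ᵐ[μ] g := by
  have h1 : hf.toLp f = hg.toLp g := by
    refine (coeffBasis μ hrep).repr.injective (lp.ext (funext fun a => ?_))
    rw [HilbertBasis.repr_apply_apply, HilbertBasis.repr_apply_apply, coeffBasis_apply,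
      normalizedCoeff, inner_smul_left, inner_smul_left, inner_coeff_toLp, inner_coeff_toLp, h]
  exact (MemLp.toLp_eq_toLp_iff hf hg).mp h1

/-- The Fourier series of a square integrable function, grouped by irreducible representations. -/
theorem hasSum_fourier (hrep : ∀ c : UnitaryDual G, (⟦rep c⟧ : UnitaryDual G) = c)
    {f : G → ℂ} (hf : MemLp f 2 μ) :
    HasSum (fun c => ∑ p : Fin (rep c).dim × Fin (rep c).dim,
      (((rep c).dim : ℂ) * fourier μ f (rep c) p.2 p.1) • coeff μ (rep c) p.1 p.2) (hf.toLp f) := by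
  -- The basis expansion is grouped into one finite block per class. The factor d_ξ arises as √d_ξ ·
  -- √d_ξ, once from the coefficient and once from the basis vector.
  refine HasSum.sigma ((coeffBasis μ hrep).hasSum_repr (hf.toLp f)) fun c => ?_
  convert! hasSum_fintype _ using 1
  refine Finset.sum_congr rfl fun p _ => ?_
  rw [HilbertBasis.repr_apply_apply, coeffBasis_apply, normalizedCoeff, inner_smul_left,
    inner_coeff_toLp, smul_smul, Complex.conj_ofReal, mul_right_comm, ← Complex.ofReal_mul,
    Real.mul_self_sqrt (Nat.cast_nonneg _), Complex.ofReal_natCast]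

theorem tendsto_eLpNorm_fourier (hrep : ∀ c : UnitaryDual G, (⟦rep c⟧ : UnitaryDual G) = c)
    {f : G → ℂ} (hf : MemLp f 2 μ) :
    Tendsto (fun s : Finset (UnitaryDual G) => eLpNorm (fun x => f x - ∑ c ∈ s,
      ((rep c).dim : ℂ) * ((rep c).mat x * fourier μ f (rep c)).trace) 2 μ) atTop (𝓝 0) := by
  have h := (Lp.tendsto_Lp_iff_tendsto_eLpNorm' _ _).mp (hasSum_fourier hrep hf)
  refine h.congr fun s => ?_
  rw [← eLpNorm_neg]
  refine eLpNorm_congr_ae ?_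
  have h1 : ∀ᵐ x ∂μ, ∀ c ∈ s, (∑ p : Fin (rep c).dim × Fin (rep c).dim,
      (((rep c).dim : ℂ) * fourier μ f (rep c) p.2 p.1) • coeff μ (rep c) p.1 p.2 : Lp ℂ 2 μ) x
      = ((rep c).dim : ℂ) * ((rep c).mat x * fourier μ f (rep c)).trace := by
    refine (Finset.eventually_all s).mpr fun c _ => ?_
    filter_upwards [sum_smul_coeff_ae_eq μ Finset.univ
      (fun p : Fin (rep c).dim × Fin (rep c).dim =>
        ((rep c).dim : ℂ) * fourier μ f (rep c) p.2 p.1) (rep c) Prod.fst Prod.snd] with x hx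
    rw [hx, Matrix.trace, Finset.mul_sum, Fintype.sum_prod_type]
    refine Finset.sum_congr rfl fun i _ => ?_
    rw [Matrix.diag_apply, Matrix.mul_apply, Finset.mul_sum]
    refine Finset.sum_congr rfl fun j _ => ?_
    ring
  filter_upwards [h1, hf.coeFn_toLp, Lp.coeFn_finsetSum s fun c =>
    (∑ p : Fin (rep c).dim × Fin (rep c).dim,
      (((rep c).dim : ℂ) * fourier μ f (rep c) p.2 p.1) • coeff μ (rep c) p.1 p.2 : Lp ℂ 2 μ)]
    with x hx1 hx2 hx3
  rw [Pi.neg_apply, Pi.sub_apply, neg_sub, hx2, hx3]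
  congr 1
  simp only [Finset.sum_apply]
  exact Finset.sum_congr rfl hx1

end FourierSeries

/-! ### Convolution kernels, their symbols and their operators -/

section ConvolutionKernel

variable {G : Type*} [Group G] [TopologicalSpace G] [IsTopologicalGroup G] [CompactSpace G]
  [SecondCountableTopology G] [MeasurableSpace G] [BorelSpace G] {μ : Measure G}
  [IsProbabilityMeasure μ]

omit [IsTopologicalGroup G] [CompactSpace G] [SecondCountableTopology G] [MeasurableSpace G]
  [BorelSpace G] in
theorem kernelTerm_eq (ξ : UnitaryIrrep G) (σ : Matrix (Fin ξ.dim) (Fin ξ.dim) ℂ) (x y : G) :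
    kernelTerm ξ σ x y = (ξ.dim : ℂ) * (ξ.mat (y⁻¹ * x) * σ).trace := by
  rw [kernelTerm, Matrix.trace_mul_comm, ← Matrix.mul_assoc, UnitaryIrrep.mat_mul,
    UnitaryIrrep.mat_inv]

omit [CompactSpace G] in
-- This makes pullback along (x,y) ↦ y⁻¹x preserve L² norms, carrying statements about k over to K.
theorem measurePreserving_inv_mul [μ.IsMulLeftInvariant] :
    MeasurePreserving (fun p : G × G => p.2⁻¹ * p.1) (μ.prod μ) μ :=
  measurePreserving_snd.comp (measurePreserving_prod_inv_mul_swap μ μ)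

theorem hasSymbolExpansion [μ.IsHaarMeasure] [μ.IsMulRightInvariant] [μ.IsInvInvariant]
    {rep : UnitaryDual G → UnitaryIrrep G}
    (hrep : ∀ c : UnitaryDual G, (⟦rep c⟧ : UnitaryDual G) = c) {k : G → ℂ} (hk : MemLp k 2 μ)
    {K : G → G → ℂ} (hK : ∀ᵐ p ∂(μ.prod μ), K p.1 p.2 = k (p.2⁻¹ * p.1)) :
    HasSymbolExpansion μ rep (fourier μ k) K := by
  refine (tendsto_eLpNorm_fourier hrep hk).congr fun s => ?_
  have hmeas : AEStronglyMeasurable (fun x => k x - ∑ c ∈ s,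
      ((rep c).dim : ℂ) * ((rep c).mat x * fourier μ k (rep c)).trace) μ := by
    refine hk.1.sub (Continuous.aestronglyMeasurable ?_)
    refine continuous_finsetSum _ fun c _ => continuous_const.mul (Continuous.matrix_trace ?_)
    exact (continuous_matrix (rep c).continuous_mat).matrix_mul continuous_const
  rw [← eLpNorm_comp_measurePreserving hmeas measurePreserving_inv_mul]
  refine eLpNorm_congr_ae ?_
  filter_upwards [hK] with p hp
  simp only [Function.comp_apply, hp, kernelTerm_eq]

omit [CompactSpace G] in
/-- The kernel `k(y⁻¹x)` is symmetric if and only if `k(z) = conj k(z⁻¹)`. -/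
theorem isSymmetricKernel_iff [μ.IsMulLeftInvariant] {k : G → ℂ} {K : G → G → ℂ}
    (hK : ∀ᵐ p ∂(μ.prod μ), K p.1 p.2 = k (p.2⁻¹ * p.1)) :
    IsSymmetricKernel μ K ↔ ∀ᵐ z ∂μ, k z = star (k z⁻¹) := by
  have hK' : ∀ᵐ p ∂(μ.prod μ), K p.2 p.1 = k (p.1⁻¹ * p.2) :=
    Measure.measurePreserving_swap.quasiMeasurePreserving.ae hK
  constructor
  · intro h
    -- The variables are swapped so that fixing the first one leaves a left translate of a statement
    -- in the second.
    have h1 : ∀ᵐ p ∂(μ.prod μ), k (p.1⁻¹ * p.2) = star (k (p.1⁻¹ * p.2)⁻¹) := by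
      filter_upwards [hK, hK', Measure.measurePreserving_swap.quasiMeasurePreserving.ae h]
        with p h1 h2 h3
      rw [mul_inv_rev, inv_inv, ← h1, ← h2]
      exact h3
    obtain ⟨y, hy⟩ := (Measure.ae_ae_of_ae_prod h1).exists
    exact (eventually_mul_left_iff μ y⁻¹).mp hy
  · intro h
    filter_upwards [hK, hK', measurePreserving_inv_mul.quasiMeasurePreserving.ae h] with p h1 h2 h3
    rw [h1, h2, h3, mul_inv_rev, inv_inv]

omit [CompactSpace G] [SecondCountableTopology G] [IsProbabilityMeasure μ] in
theorem fourier_star_inv [μ.IsInvInvariant] (k : G → ℂ) (ξ : UnitaryIrrep G) :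
    fourier μ (fun z => star (k z⁻¹)) ξ = (fourier μ k ξ)ᴴ := by
  ext i j
  simp only [fourier, Matrix.of_apply, Matrix.conjTranspose_apply]
  rw [← integral_inv_eq_self, RCLike.star_def, ← integral_conj]
  refine integral_congr_ae (Eventually.of_forall fun x => ?_)
  simp [UnitaryIrrep.mat_inv]

/-- The functions k(z) and conj k(z⁻¹) have transforms σ and σᴴ, and a square integrable function is
determined by its transform. -/
theorem isSymmetricKernel_iff_isHermitian [μ.IsHaarMeasure] [μ.IsMulRightInvariant]
    [μ.IsInvInvariant] {rep : UnitaryDual G → UnitaryIrrep G}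
    (hrep : ∀ c : UnitaryDual G, (⟦rep c⟧ : UnitaryDual G) = c) {k : G → ℂ} (hk : MemLp k 2 μ)
    {K : G → G → ℂ} (hK : ∀ᵐ p ∂(μ.prod μ), K p.1 p.2 = k (p.2⁻¹ * p.1)) :
    IsSymmetricKernel μ K ↔ ∀ c, (fourier μ k (rep c)).IsHermitian := by
  rw [isSymmetricKernel_iff hK]
  constructor
  · intro h c
    rw [Matrix.IsHermitian, ← fourier_star_inv]
    ext i j
    refine integral_congr_ae ?_
    filter_upwards [h] with z hz
    rw [← hz]
  · intro h
    have hk' : MemLp (fun z => star (k z⁻¹)) 2 μ :=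
      (hk.comp_measurePreserving (Measure.measurePreserving_inv μ)).star
    exact ae_eq_of_fourier_eq hrep hk hk' fun c => by rw [fourier_star_inv, h c]

/-- The matrix symbol describes the action of a convolution operator on matrix coefficients. -/
theorem apply_coeff [μ.IsMulRightInvariant] [μ.IsInvInvariant] {k : G → ℂ} (hk : MemLp k 2 μ)
    {K : G → G → ℂ} (hK : ∀ᵐ p ∂(μ.prod μ), K p.1 p.2 = k (p.2⁻¹ * p.1))
    {T : Lp ℂ 2 μ →L[ℂ] Lp ℂ 2 μ} (hT : HasIntegralKernel μ T K) (ξ : UnitaryIrrep G)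
    (i j : Fin ξ.dim) : T (coeff μ ξ i j) = ∑ m, fourier μ k ξ m j • coeff μ ξ i m := by
  refine Lp.ext ?_
  filter_upwards [hT (coeff μ ξ i j), sum_smul_coeff_ae_eq μ Finset.univ
    (fun m => fourier μ k ξ m j) ξ (fun _ => i) fun m => m, Measure.ae_ae_of_ae_prod hK]
    with x h1 h2 h3
  rw [h1, h2]
  have h4 : ∫ y, K x y * coeff μ ξ i j y ∂μ = ∫ y, k (y⁻¹ * x) * ξ.mat y i j ∂μ := by
    refine integral_congr_ae ?_
    filter_upwards [h3, coeff_ae_eq μ ξ i j] with y h5 h6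
    rw [h5, h6]
  -- Substitution y = xz⁻¹, as an inversion followed by a right translation.
  have h5 : ∫ y, k (y⁻¹ * x) * ξ.mat y i j ∂μ = ∫ z, k z * ξ.mat (x * z⁻¹) i j ∂μ := by
    rw [← integral_inv_eq_self, ← integral_mul_right_eq_self _ x⁻¹]
    simp
  -- On a probability space k ∈ L² is integrable, and entries of unitary matrices are bounded by 1.
  have hint : ∀ m, Integrable (fun z => k z * star (ξ.mat z j m)) μ := fun m =>
    (hk.integrable (by simp)).mul_bdd (c := 1) (ξ.continuous_mat j m).star.aestronglyMeasurable
      (Eventually.of_forall fun z => by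
        rw [norm_star]
        exact entry_norm_bound_of_unitary (ξ.toHom z).2 j m)
  rw [h4, h5]
  simp only [UnitaryIrrep.mat_mul, UnitaryIrrep.mat_inv, Matrix.mul_apply,
    Matrix.conjTranspose_apply, Finset.mul_sum, fourier, Matrix.of_apply]
  rw [integral_finsetSum]
  · refine Finset.sum_congr rfl fun m _ => ?_
    rw [← integral_mul_const]
    exact integral_congr_ae (Eventually.of_forall fun z => by dsimp only; ring)
  · intro m _
    exact ((hint m).const_mul (ξ.mat x i m)).congr
      (Eventually.of_forall fun z => by dsimp only; ring)

/-- By Schur orthogonality ⟨ξ_{ij}, Tξ_{ml}⟩ = δ_{im} σ_{jl}/d_ξ, while T maps coefficients of ξ to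
combinations of such, so different classes do not interact. Hence T is symmetric on the basis
exactly when every σ(ξ) is Hermitian. -/
theorem isSelfAdjoint_iff_isHermitian [μ.IsHaarMeasure] [μ.IsMulRightInvariant]
    [μ.IsInvInvariant] {rep : UnitaryDual G → UnitaryIrrep G}
    (hrep : ∀ c : UnitaryDual G, (⟦rep c⟧ : UnitaryDual G) = c) {k : G → ℂ} (hk : MemLp k 2 μ)
    {K : G → G → ℂ} (hK : ∀ᵐ p ∂(μ.prod μ), K p.1 p.2 = k (p.2⁻¹ * p.1))
    {T : Lp ℂ 2 μ →L[ℂ] Lp ℂ 2 μ} (hT : HasIntegralKernel μ T K) :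
    IsSelfAdjoint T ↔ ∀ c, (fourier μ k (rep c)).IsHermitian := by
  have hleft : ∀ c (i j l : Fin (rep c).dim) (m : Fin (rep c).dim),
      inner ℂ (coeff μ (rep c) i j) (T (coeff μ (rep c) m l))
        = if i = m then fourier μ k (rep c) j l * ((rep c).dim : ℂ)⁻¹ else 0 := by
    intro c i j l m
    rw [apply_coeff hk hK hT, inner_sum]
    simp only [inner_smul_right, inner_coeff_coeff, UnitaryIrrep.integral_mat_mul_star_self]
    by_cases him : i = m
    · simp [him]
    · simp [him, Ne.symm him]
  constructor
  · intro h c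
    ext j l
    -- Any row serves, since T acts by the same matrix on each; row 0 exists because d_ξ > 0.
    let i : Fin (rep c).dim := ⟨0, (rep c).dim_pos⟩
    have hd : ((rep c).dim : ℂ)⁻¹ ≠ 0 := inv_ne_zero (by exact_mod_cast (rep c).dim_pos.ne')
    have h1 := hleft c i j l i
    have h2 := hleft c i l j i
    have h3 := h.isSymmetric (coeff μ (rep c) i j) (coeff μ (rep c) i l)
    change inner ℂ (T (coeff μ (rep c) i j)) _ = inner ℂ _ (T (coeff μ (rep c) i l)) at h3
    rw [h1, ← inner_conj_symm, h2, if_pos rfl, if_pos rfl, map_mul, map_inv₀, map_natCast] at h3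
    exact mul_right_cancel₀ hd h3
  · intro h
    have hb : ∀ a b : CoeffIndex rep,
        inner ℂ (T (coeff μ (rep a.1) a.2.1 a.2.2)) (coeff μ (rep b.1) b.2.1 b.2.2)
          = inner ℂ (coeff μ (rep a.1) a.2.1 a.2.2) (T (coeff μ (rep b.1) b.2.1 b.2.2)) := by
      rintro ⟨c, i, j⟩ ⟨c', m, l⟩
      by_cases hc : c = c'
      · subst hc
        rw [← inner_conj_symm, hleft, hleft]
        by_cases him : i = m
        · rw [if_pos him, if_pos him.symm, map_mul, map_inv₀, map_natCast]
          congr 1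
          exact congrFun (congrFun (h c) j) l
        · rw [if_neg him, if_neg (Ne.symm him), map_zero]
      · have h0 : ∀ (p q : Fin (rep c).dim) (r s : Fin (rep c').dim),
            inner ℂ (coeff μ (rep c) p q) (coeff μ (rep c') r s) = 0 := fun p q r s => by
          rw [inner_coeff_rep μ hrep ⟨c, p, q⟩ ⟨c', r, s⟩, if_neg]
          exact fun h => hc (congrArg Sigma.fst h)
        simp only [apply_coeff hk hK hT, inner_sum, sum_inner, inner_smul_left, inner_smul_right,
          h0, mul_zero, Finset.sum_const_zero]
    have hb' : ∀ a b : CoeffIndex rep,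
        inner ℂ (T (normalizedCoeff μ rep a)) (normalizedCoeff μ rep b)
          = inner ℂ (normalizedCoeff μ rep a) (T (normalizedCoeff μ rep b)) := by
      intro a b
      simp only [normalizedCoeff, map_smul, inner_smul_left, inner_smul_right, hb]
    -- T and its adjoint are continuous, so agreement on a total set suffices.
    have hdense : Dense (Submodule.span ℂ (Set.range (coeffBasis μ hrep)) : Set (Lp ℂ 2 μ)) :=
      Submodule.dense_iff_topologicalClosure_eq_top.mpr (coeffBasis μ hrep).dense_span
    rw [ContinuousLinearMap.isSelfAdjoint_iff']
    refine ContinuousLinearMap.ext_on hdense ?_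
    rintro _ ⟨b, rfl⟩
    refine (coeffBasis μ hrep).repr.injective (lp.ext (funext fun a => ?_))
    rw [HilbertBasis.repr_apply_apply, HilbertBasis.repr_apply_apply,
      ContinuousLinearMap.adjoint_inner_right, coeffBasis_apply, coeffBasis_apply, hb']

end ConvolutionKernel

end CompactLieKernel

end

theorem theorem3p3 {n : ℕ} {G : Type*} [Group G] [TopologicalSpace G] [CompactSpace G] [T2Space G]
    [ChartedSpace (EuclideanSpace ℝ (Fin n)) G] [LieGroup (𝓡 n) ∞ G]
    [MeasurableSpace G] [BorelSpace G]
    (μ : Measure G) [μ.IsHaarMeasure] [IsProbabilityMeasure μ]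
    (rep : CompactLieKernel.UnitaryDual G → CompactLieKernel.UnitaryIrrep G)
    (hrep : ∀ c : CompactLieKernel.UnitaryDual G, (⟦rep c⟧ : CompactLieKernel.UnitaryDual G) = c)
    (k : G → ℂ) (hk : MemLp k 2 μ)
    (K : G → G → ℂ) (hK : ∀ᵐ p ∂(μ.prod μ), K p.1 p.2 = k (p.2⁻¹ * p.1))
    (T : Lp ℂ 2 μ →L[ℂ] Lp ℂ 2 μ) (hT : CompactLieKernel.HasIntegralKernel μ T K) :
    CompactLieKernel.HasSymbolExpansion μ rep (CompactLieKernel.fourier μ k) K ∧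
    List.TFAE
      [CompactLieKernel.IsSymmetricKernel μ K,
       ∀ c : CompactLieKernel.UnitaryDual G,
         (CompactLieKernel.fourier μ k (rep c)).IsHermitian,
       IsSelfAdjoint T] := by
  -- The Lie structure enters only through the topological group property and second countability.
  have : IsTopologicalGroup G := topologicalGroup_of_lieGroup (𝓡 n) ∞
  have : SecondCountableTopology G :=
    ChartedSpace.secondCountable_of_sigmaCompact (EuclideanSpace ℝ (Fin n)) G
  have := CompactLieKernel.isMulRightInvariant_of_compactSpace μ
  have := CompactLieKernel.isInvInvariant_of_compactSpace μ
  refine ⟨CompactLieKernel.hasSymbolExpansion hrep hk hK, ?_⟩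
  tfae_have 1 ↔ 2 := CompactLieKernel.isSymmetricKernel_iff_isHermitian hrep hk hK
  tfae_have 3 ↔ 2 := CompactLieKernel.isSelfAdjoint_iff_isHermitian hrep hk hK hT
  tfae_finish
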